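/- Let $S$ be a semigroup and $T$ a subsemigroup of $S$. Write $uT^1=\{u\}\cup uT$ and $T^1u=\{u\}\cup Tu$ for $u\in S$, and let $\mathcal{H}^T$ be the equivalence relation on $S$ given by $u\,\mathcal{H}^T\,v$ if and only if $uT^1=vT^1$ and $T^1u=T^1v$. The Green index of $T$ in $S$ is one more than the number of $\mathcal{H}^T$-classes in $S\setminus T$ (every class lies wholly in $T$ or wholly in $S\setminus T$). A semigroup $S$ is word-hyperbolic if there are a finite alphabet $A$ whose letters represent a generating set of $S$ and a regular language $L\subseteq A^+$ such that every element of $S$ is represented by some word of $L$ and the language \[ M(L)=\{u\#_1v\#_2w^{\mathrm{rev}} : u,v,w\in L,\ uv=_S w\} \] is context-free, where $\#_1,\#_2$ are two distinct new symbols not in $A$, $w^{\mathrm{rev}}$ is the reverse of $w$, and $uv=_Sw$ means that the words $uv$ and $w$ represent the same element of $S$. Theorem. If $S$ is a word-hyperbolic semigroup and $T$ is a subsemigroup of finite Green index in $S$, then $T$ is word-hyperbolic. -/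

import Mathlib

/-! ### Relative Green's relations and the Green index

`T¹` is `T` with an identity adjoined, acting as an identity on all of `S`, so that
`u T¹ = {u} ∪ u T` and `T¹ u = {u} ∪ T u`. -/

namespace Subsemigroup

variable {S : Type*} [Semigroup S]

/-- The set `u T¹ = {u} ∪ {u t : t ∈ T}`. -/
def rightTranslates (T : Subsemigroup S) (u : S) : Set S :=
  {x | x = u ∨ ∃ t ∈ T, x = u * t}

/-- The set `T¹ u = {u} ∪ {t u : t ∈ T}`. -/
def leftTranslates (T : Subsemigroup S) (u : S) : Set S :=
  {x | x = u ∨ ∃ t ∈ T, x = t * u}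

/-- The relative Green relation `R^T`: `u` and `v` are related iff `u T¹ = v T¹`. -/
def relativeR (T : Subsemigroup S) : Setoid S := Setoid.ker T.rightTranslates

/-- The relative Green relation `L^T`: `u` and `v` are related iff `T¹ u = T¹ v`. -/
def relativeL (T : Subsemigroup S) : Setoid S := Setoid.ker T.leftTranslates

/-- The relative Green relation `H^T`, the intersection of `R^T` and `L^T`. -/
def relativeH (T : Subsemigroup S) : Setoid S := T.relativeR ⊓ T.relativeL

/-- The Green index of `T` in `S`: one more than the number (possibly infinite) of relative
`H^T`-classes in `S \ T`. -/
noncomputable def greenIndex (T : Subsemigroup S) : ℕ∞ :=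
  Set.encard {c : Quotient T.relativeH | ∃ s : S, s ∉ T ∧ Quotient.mk T.relativeH s = c} + 1

end Subsemigroup

/-! ### Word-hyperbolic semigroups -/

namespace WordHyperbolic

variable {A S : Type*} [Semigroup S]

/-- The element represented by a word over `A`, where the letter `a` represents `φ a`. It is taken
in `WithOne S`, the monoid obtained from `S` by adjoining a new identity: a nonempty word
represents an element of `S` and the empty word represents only the adjoined identity. -/
def eval (φ : A → S) (w : List A) : WithOne S :=
  (w.map fun a => (φ a : WithOne S)).prod

/-- The word `u #₁ v #₂ wʳᵉᵛ` over `A` extended by two new symbols `#₁ = inr 0`, `#₂ = inr 1`. -/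
def tripleWord (u v w : List A) : List (A ⊕ Fin 2) :=
  u.map Sum.inl ++ [Sum.inr 0] ++ v.map Sum.inl ++ [Sum.inr 1] ++ w.reverse.map Sum.inl

/-- The language `M(L) = {u #₁ v #₂ wʳᵉᵛ : u, v, w ∈ L, u v = w in S}`. -/
def multLanguage (φ : A → S) (L : Language A) : Language (A ⊕ Fin 2) :=
  {x | ∃ u ∈ L, ∃ v ∈ L, ∃ w ∈ L, eval φ (u ++ v) = eval φ w ∧ x = tripleWord u v w}

/-- `(L, M(L))` is a word-hyperbolic structure for `S`, where `L` is a language of nonempty words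
over the alphabet `A` whose letters represent elements of `S` via `φ`. -/
structure IsStructure (φ : A → S) (L : Language A) : Prop where
  finite_alphabet : Finite A
  closure_range : Subsemigroup.closure (Set.range φ) = ⊤
  nonempty_words : ∀ w ∈ L, w ≠ []
  regular : L.IsRegular
  surjective : ∀ s : S, ∃ w ∈ L, eval φ w = (s : WithOne S)
  contextFree : (multLanguage φ L).IsContextFree

end WordHyperbolic

/-- A semigroup is word-hyperbolic if it admits a word-hyperbolic structure. -/
def IsWordHyperbolic (S : Type*) [Semigroup S] : Prop :=
  ∃ (A : Type) (φ : A → S) (L : Language A), WordHyperbolic.IsStructure φ L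

/-! ### Finite letter transducers -/

/-! Let `h k` run over representatives of the `H^T`-classes outside `T`, with `h none = 1`, and
compute in `S` with an identity adjoined. Scanning a word `a₁…aₙ` from the right, `R^T` gives `aᵢ h
k = h k' σᵢ` with `σᵢ ∈ T¹`, so the word equals `h k σ₁…σₙ`. Pushing `h k` back from left to right,
`L^T` gives `h m σᵢ = τᵢ h m'` with `τᵢ ∈ T¹`. If the word represents an element of `T¹`, the
representative left at the end is `1`, so the word equals `τ₁…τₙ`. Each `τᵢ` depends only on `(m,
aᵢ, k)`, so finitely many letters suffice.

A finite transducer performs this rewriting, guessing the right-to-left information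
nondeterministically (`exists_of_run_pushTransducer`, `exists_run_pushTransducer`). Its image of `L`
is regular, and `M` of that image is the image of `M(L)` under a transducer treating the three words
separately, hence context-free (`isRegular_image`, `isContextFree_image`,
`IsStructure.of_transducer`). -/

/-- A nondeterministic transducer reading one letter and writing at most one letter per step. -/
structure LetterTransducer (A B Q : Type*) where
  step : Q → A → Option B → Q → Prop
  start : Set Q
  accept : Set Q

namespace LetterTransducer

variable {A B Q : Type*}

/-- `M.Run p w x q`: there is a run from `p` to `q` reading `w` and writing `x`. -/
inductive Run (M : LetterTransducer A B Q) : Q → List A → List B → Q → Prop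
  | nil (q : Q) : Run M q [] [] q
  | cons {p r q : Q} {a : A} {o : Option B} {w : List A} {x : List B} :
      M.step p a o r → Run M r w x q → Run M p (a :: w) (o.toList ++ x) q

/-- The relation between words computed by a transducer. -/
def Rel (M : LetterTransducer A B Q) (w : List A) (x : List B) : Prop :=
  ∃ p ∈ M.start, ∃ q ∈ M.accept, M.Run p w x q

/-- The image of a language under a transducer. -/
def image (M : LetterTransducer A B Q) (L : Language A) : Language B :=
  {x | ∃ w ∈ L, M.Rel w x}

variable {M : LetterTransducer A B Q}

@[simp]
lemma run_nil_iff {p q : Q} {x : List B} : M.Run p [] x q ↔ x = [] ∧ p = q := by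
  constructor
  · rintro ⟨⟩
    exact ⟨rfl, rfl⟩
  · rintro ⟨rfl, rfl⟩
    exact .nil p

lemma run_cons_iff {p q : Q} {a : A} {w : List A} {x : List B} :
    M.Run p (a :: w) x q ↔
      ∃ o r y, M.step p a o r ∧ M.Run r w y q ∧ x = o.toList ++ y := by
  constructor
  · rintro (_ | ⟨h, h'⟩)
    exact ⟨_, _, _, h, h', rfl⟩
  · rintro ⟨o, r, y, h, h', rfl⟩
    exact .cons h h'

lemma run_append_iff {p q : Q} {u v : List A} {x : List B} :
    M.Run p (u ++ v) x q ↔ ∃ r y z, M.Run p u y r ∧ M.Run r v z q ∧ x = y ++ z := by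
  induction u generalizing p x with
  | nil => simp
  | cons a u ih =>
    simp only [List.cons_append, run_cons_iff, ih]
    constructor
    · rintro ⟨o, r, _, h, ⟨s, y, z, hy, hz, rfl⟩, rfl⟩
      exact ⟨s, _, z, ⟨o, r, y, h, hy, rfl⟩, hz, by simp⟩
    · rintro ⟨s, _, z, ⟨o, r, y, h, hy, rfl⟩, hz, rfl⟩
      exact ⟨o, r, _, h, ⟨s, y, z, hy, hz, rfl⟩, by simp⟩

lemma run_singleton_iff {p q : Q} {a : A} {x : List B} :
    M.Run p [a] x q ↔ ∃ o, M.step p a o q ∧ x = o.toList := by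
  simp only [run_cons_iff, run_nil_iff]
  constructor
  · rintro ⟨o, r, _, h, ⟨rfl, rfl⟩, rfl⟩
    exact ⟨o, h, by simp⟩
  · rintro ⟨o, h, rfl⟩
    exact ⟨o, q, [], h, ⟨rfl, rfl⟩, by simp⟩

/-- A step writes at most one letter, so every cut of the output falls between two steps. -/
lemma Run.split_output {p q : Q} {w : List A} {z : List B} (h : M.Run p w z q) {x y : List B}
    (hz : z = x ++ y) :
    ∃ w₁ w₂ r, w = w₁ ++ w₂ ∧ M.Run p w₁ x r ∧ M.Run r w₂ y q := by
  induction h generalizing x with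
  | nil q =>
    obtain ⟨rfl, rfl⟩ := List.append_eq_nil_iff.1 hz.symm
    exact ⟨[], [], q, rfl, .nil q, .nil q⟩
  | @cons p r q a o w z' hs hr ih =>
    cases o with
    | none =>
      obtain ⟨w₁, w₂, s, rfl, h₁, h₂⟩ := ih hz
      exact ⟨a :: w₁, w₂, s, rfl, .cons hs h₁, h₂⟩
    | some b =>
      cases x with
      | nil =>
        refine ⟨[], a :: w, p, rfl, .nil p, ?_⟩
        rw [List.nil_append] at hz
        rw [← hz]
        exact .cons hs hr
      | cons c x =>
        obtain ⟨rfl, hz'⟩ : b = c ∧ z' = x ++ y := by simpa using hz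
        obtain ⟨w₁, w₂, s, rfl, h₁, h₂⟩ := ih hz'
        exact ⟨a :: w₁, w₂, s, rfl, .cons hs h₁, h₂⟩

/-- The image of a regular language under a finite letter transducer is regular. -/
theorem isRegular_image [Finite Q] (M : LetterTransducer A B Q) {L : Language A}
    (hL : L.IsRegular) : (M.image L).IsRegular := by
  obtain ⟨σ, _, D, rfl⟩ := hL
  -- Myhill–Nerode: the left quotient by `x` depends only on the set of pairs (automaton state,
  -- transducer state) reachable while writing `x`, and there are finitely many such sets.
  let reached (x : List B) : Set (σ × Q) := {s | ∃ w, D.eval w = s.1 ∧ ∃ p ∈ M.start, M.Run p w x s.2}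
  let rest (P : Set (σ × Q)) : Language B :=
    {y | ∃ s ∈ P, ∃ w, D.evalFrom s.1 w ∈ D.accept ∧ ∃ q ∈ M.accept, M.Run s.2 w y q}
  apply Language.IsRegular.of_finite_range_leftQuotient
  refine (Set.finite_range rest).subset ?_
  rintro _ ⟨x, rfl⟩
  refine ⟨reached x, ?_⟩
  ext y
  constructor
  · rintro ⟨s, ⟨w₁, hw₁, p, hp, h₁⟩, w₂, hw₂, q, hq, h₂⟩
    refine ⟨w₁ ++ w₂, ?_, p, hp, q, hq, run_append_iff.2 ⟨_, _, _, h₁, h₂, rfl⟩⟩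
    rw [DFA.mem_accepts, DFA.eval, DFA.evalFrom_of_append]
    rw [← hw₁] at hw₂
    exact hw₂
  · rintro ⟨w, hw, p, hp, q, hq, h⟩
    obtain ⟨w₁, w₂, r, rfl, h₁, h₂⟩ := h.split_output rfl
    refine ⟨(D.eval w₁, r), ⟨w₁, rfl, p, hp, h₁⟩, w₂, ?_, q, hq, h₂⟩
    rw [DFA.mem_accepts, DFA.eval, DFA.evalFrom_of_append] at hw
    exact hw

end LetterTransducer

/-! ### Derivation trees of context-free grammars -/

namespace ContextFreeGrammar

variable {T : Type*}

/-- `g.Yields s w`: there is a forest of derivation trees with roots `s` and leaves `w`. -/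
inductive Yields (g : ContextFreeGrammar T) : List (Symbol T g.NT) → List T → Prop
  | nil : Yields g [] []
  | terminal (a : T) {s : List (Symbol T g.NT)} {w : List T} :
      Yields g s w → Yields g (.terminal a :: s) (a :: w)
  | nonterminal {r : ContextFreeRule T g.NT} {s : List (Symbol T g.NT)} {u v : List T} :
      r ∈ g.rules → Yields g r.output u → Yields g s v →
        Yields g (.nonterminal r.input :: s) (u ++ v)

variable {g : ContextFreeGrammar T}

lemma Yields.append {s t : List (Symbol T g.NT)} {u v : List T} (hs : g.Yields s u)
    (ht : g.Yields t v) : g.Yields (s ++ t) (u ++ v) := by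
  induction hs with
  | nil => exact ht
  | terminal a _ ih => exact .terminal a ih
  | nonterminal hr hu _ _ ih =>
    rw [List.append_assoc]
    exact .nonterminal hr hu ih

lemma Yields.exists_of_append {s t : List (Symbol T g.NT)} {w : List T}
    (h : g.Yields (s ++ t) w) : ∃ u v, g.Yields s u ∧ g.Yields t v ∧ w = u ++ v := by
  induction s generalizing w with
  | nil => exact ⟨[], w, .nil, h, rfl⟩
  | cons X s ih =>
    rcases h with _ | ⟨a, h⟩ | ⟨hr, hu, h⟩
    · obtain ⟨u, v, hu, hv, rfl⟩ := ih h
      exact ⟨_, v, .terminal a hu, hv, rfl⟩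
    · obtain ⟨u', v, hu', hv, rfl⟩ := ih h
      exact ⟨_, v, .nonterminal hr hu hu', hv, by simp⟩

lemma yields_map_terminal_iff {w x : List T} :
    g.Yields (w.map .terminal) x ↔ x = w := by
  induction w generalizing x with
  | nil =>
    constructor
    · rintro ⟨⟩
      rfl
    · rintro rfl
      exact .nil
  | cons a w ih =>
    constructor
    · rintro (_ | ⟨_, h⟩)
      rw [ih.1 h]
    · rintro rfl
      exact .terminal a (ih.2 rfl)

/-- The trees grown from the output of the rule are grafted under one new node. Forests are used
because they split along concatenations, as runs do. -/
lemma Yields.of_produces {s t : List (Symbol T g.NT)} {w : List T} (h : g.Produces s t)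
    (ht : g.Yields t w) : g.Yields s w := by
  obtain ⟨r, hr, hst⟩ := h
  obtain ⟨p, q, rfl, rfl⟩ := hst.exists_parts
  obtain ⟨_, v, h, hv, rfl⟩ := ht.exists_of_append
  obtain ⟨x, y, hx, hy, rfl⟩ := h.exists_of_append
  rw [List.append_assoc, List.append_assoc]
  exact hx.append (.nonterminal hr hy hv)

lemma yields_iff_derives {s : List (Symbol T g.NT)} {w : List T} :
    g.Yields s w ↔ g.Derives s (w.map .terminal) := by
  constructor
  · intro h
    induction h with
    | nil => exact .refl _
    | terminal a _ ih => exact ih.append_left [.terminal a]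
    | @nonterminal r s u v hr _ _ ihu ihv =>
      have h₁ : g.Produces ([.nonterminal r.input] ++ s) (r.output ++ s) :=
        ⟨r, hr, ContextFreeRule.Rewrites.input_output.append_right s⟩
      rw [List.map_append]
      exact h₁.trans_derives ((ihu.append_right s).trans (ihv.append_left _))
  · intro h
    induction h using Relation.ReflTransGen.head_induction_on with
    | refl => exact yields_map_terminal_iff.2 rfl
    | head h _ ih => exact ih.of_produces h

lemma mem_language_iff_yields {w : List T} :
    w ∈ g.language ↔ g.Yields [.nonterminal g.initial] w := by
  rw [mem_language_iff, yields_iff_derives]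

end ContextFreeGrammar


/-! ### Images of context-free languages under letter transducers -/

namespace LetterTransducer

variable {B : Type*} {A N Q : Type}

/-- Annotate a string of symbols with the states visited before and after each symbol. -/
def annotate : Q → List (Symbol A N) → List Q → List (Symbol B (Option (Q × Symbol A N × Q)))
  | p, X :: s, q :: qs => .nonterminal (some (p, X, q)) :: annotate q s qs
  | _, _, _ => []

/-- The rules of the image grammar: annotated rules of `g`, rules for the steps of `M`, and rules
for the initial symbol. -/
inductive ImageRule (M : LetterTransducer A B Q) (g : ContextFreeGrammar A) :
    ContextFreeRule B (Option (Q × Symbol A g.NT × Q)) → Prop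
  | branch {r : ContextFreeRule A g.NT} (hr : r ∈ g.rules) (p : Q) {qs : List Q}
      (hqs : qs.length = r.output.length) :
      ImageRule M g ⟨some (p, .nonterminal r.input, qs.getLastD p), annotate p r.output qs⟩
  | step {p q : Q} {a : A} {o : Option B} (h : M.step p a o q) :
      ImageRule M g ⟨some (p, .terminal a, q), o.toList.map .terminal⟩
  | initial {p q : Q} (hp : p ∈ M.start) (hq : q ∈ M.accept) :
      ImageRule M g ⟨none, [.nonterminal (some (p, .nonterminal g.initial, q))]⟩

lemma finite_imageRule [Finite A] [Finite B] [Finite Q] (M : LetterTransducer A B Q)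
    (g : ContextFreeGrammar A) : {r | ImageRule M g r}.Finite := by
  have h₁ : (⋃ r ∈ g.rules, ⋃ p : Q,
      (fun qs : List Q => (⟨some (p, .nonterminal r.input, qs.getLastD p), annotate p r.output qs⟩ :
        ContextFreeRule B (Option (Q × Symbol A g.NT × Q)))) ''
          {qs | qs.length = r.output.length}).Finite :=
    g.rules.finite_toSet.biUnion fun r _ => Set.finite_iUnion fun p =>
      (List.finite_length_eq Q _).image _
  have h₂ := Set.finite_range (fun d : Q × A × Option B × Q =>
    (⟨some (d.1, .terminal d.2.1, d.2.2.2), d.2.2.1.toList.map .terminal⟩ :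
      ContextFreeRule B (Option (Q × Symbol A g.NT × Q))))
  have h₃ := Set.finite_range (fun d : Q × Q =>
    (⟨none, [.nonterminal (some (d.1, .nonterminal g.initial, d.2))]⟩ :
      ContextFreeRule B (Option (Q × Symbol A g.NT × Q))))
  refine ((h₁.union h₂).union h₃).subset ?_
  rintro _ (⟨hr, p, hqs⟩ | @⟨p, q, a, o, h⟩ | @⟨p, q, hp, hq⟩)
  · refine .inl (.inl ?_)
    simp only [Set.mem_iUnion]
    exact ⟨_, hr, p, _, hqs, rfl⟩
  · exact .inl (.inr ⟨(p, a, o, q), rfl⟩)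
  · exact .inr ⟨(p, q), rfl⟩

/-- A grammar for the image of the language of `g` under `M`. -/
noncomputable def imageGrammar [Finite A] [Finite B] [Finite Q] (M : LetterTransducer A B Q)
    (g : ContextFreeGrammar A) : ContextFreeGrammar B where
  NT := Option (Q × Symbol A g.NT × Q)
  initial := none
  rules := (finite_imageRule M g).toFinset

section ContextFree

variable [Finite A] [Finite B] [Finite Q] {M : LetterTransducer A B Q} {g : ContextFreeGrammar A}

lemma mem_rules_imageGrammar {r : ContextFreeRule B (Option (Q × Symbol A g.NT × Q))} :
    r ∈ (M.imageGrammar g).rules ↔ ImageRule M g r :=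
  (finite_imageRule M g).mem_toFinset

/-- The list `qs` records where the run stands after the yield of each symbol of `s`. -/
lemma exists_yields_annotate {s : List (Symbol A g.NT)} {w : List A} (h : g.Yields s w) {p q : Q}
    {x : List B} (hx : M.Run p w x q) :
    ∃ qs : List Q, qs.length = s.length ∧ qs.getLastD p = q ∧
      (M.imageGrammar g).Yields (annotate p s qs) x := by
  induction h generalizing p q x with
  | nil =>
    obtain ⟨rfl, rfl⟩ := run_nil_iff.1 hx
    exact ⟨[], rfl, rfl, .nil⟩
  | terminal a _ ih =>
    obtain ⟨o, r, y, hs, hy, rfl⟩ := run_cons_iff.1 hx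
    obtain ⟨qs, hl, rfl, hY⟩ := ih hy
    refine ⟨r :: qs, by simp [hl], by rw [List.getLastD_cons], ?_⟩
    exact .nonterminal (mem_rules_imageGrammar.2 (.step hs))
      (ContextFreeGrammar.yields_map_terminal_iff.2 rfl) hY
  | nonterminal hr _ _ ihu ihv =>
    obtain ⟨m, y, z, hy, hz, rfl⟩ := run_append_iff.1 hx
    obtain ⟨ps, hps, rfl, hu⟩ := ihu hy
    obtain ⟨qs, hqs, rfl, hv⟩ := ihv hz
    refine ⟨_ :: qs, by simp [hqs], by rw [List.getLastD_cons], ?_⟩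
    exact .nonterminal (mem_rules_imageGrammar.2 (.branch hr p hps)) hu hv

/-- Consecutive annotated symbols share a state, so the runs obtained from their subtrees can be
concatenated. -/
lemma exists_run_of_yields {s' : List (Symbol B (M.imageGrammar g).NT)} {x : List B}
    (h : (M.imageGrammar g).Yields s' x) {p : Q} {s : List (Symbol A g.NT)} {qs : List Q}
    (hqs : qs.length = s.length) (hs' : s' = annotate p s qs) :
    ∃ w, g.Yields s w ∧ M.Run p w x (qs.getLastD p) := by
  induction h generalizing p s qs with
  | nil =>
    rcases s with _ | ⟨X, s⟩ <;> rcases qs with _ | ⟨q, qs⟩ <;> simp [annotate] at hqs hs'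
    exact ⟨[], .nil, .nil p⟩
  | terminal a _ _ =>
    rcases s with _ | ⟨X, s⟩
    · nomatch hs'
    · rcases qs with _ | ⟨q, qs⟩
      · nomatch hqs
      · injection hs' with h
        nomatch h
  | @nonterminal r t u v hr hu _ ihu ihv =>
    obtain _ | ⟨X, s⟩ := s
    · nomatch hs'
    obtain _ | ⟨q, qs⟩ := qs
    · nomatch hqs
    injection hs' with h ht
    injection h with hin
    obtain ⟨w, hw, hrun⟩ := ihv (Nat.succ.inj hqs) ht
    rw [List.getLastD_cons]
    rcases mem_rules_imageGrammar.1 hr with ⟨hr', p', hl⟩ | ⟨hst⟩ | ⟨hp, hq⟩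
    · cases hin
      obtain ⟨w', hw', hrun'⟩ := ihu hl rfl
      exact ⟨w' ++ w, .nonterminal hr' hw' hw, run_append_iff.2 ⟨_, _, _, hrun', hrun, rfl⟩⟩
    · cases hin
      obtain rfl := ContextFreeGrammar.yields_map_terminal_iff.1 hu
      exact ⟨_ :: w, .terminal _ hw, .cons hst hrun⟩
    · simp at hin

lemma language_imageGrammar : (M.imageGrammar g).language = M.image g.language := by
  ext x
  rw [ContextFreeGrammar.mem_language_iff_yields]
  constructor
  · intro h
    generalize hs : [Symbol.nonterminal (M.imageGrammar g).initial] = s at h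
    rcases h with _ | _ | ⟨hr, hu, hv⟩
    · simp at hs
    · simp at hs
    · simp only [List.cons.injEq, Symbol.nonterminal.injEq] at hs
      obtain ⟨hin, rfl⟩ := hs
      obtain rfl := (ContextFreeGrammar.yields_map_terminal_iff (w := [])).1 hv
      rcases mem_rules_imageGrammar.1 hr with ⟨hr', p', hl⟩ | ⟨hst⟩ | @⟨p, q, hp, hq⟩
      · simp [imageGrammar] at hin
      · simp [imageGrammar] at hin
      · obtain ⟨w, hw, hrun⟩ :=
          exists_run_of_yields hu (p := p) (s := [.nonterminal g.initial]) (qs := [q]) rfl rfl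
        rw [List.append_nil]
        exact ⟨w, ContextFreeGrammar.mem_language_iff_yields.2 hw, p, hp, q, hq, hrun⟩
  · rintro ⟨w, hw, p, hp, q, hq, hrun⟩
    obtain ⟨qs, hl, hlast, hY⟩ :=
      exists_yields_annotate (ContextFreeGrammar.mem_language_iff_yields.1 hw) hrun
    obtain ⟨r, rfl⟩ := List.length_eq_one_iff.1 hl
    obtain rfl : r = q := hlast
    rw [← List.append_nil x]
    exact .nonterminal (mem_rules_imageGrammar.2 (.initial hp hq)) hY .nil

/-- The image of a context-free language under a finite letter transducer is context-free. -/
theorem isContextFree_image (M : LetterTransducer A B Q) {L : Language A}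
    (hL : L.IsContextFree) : (M.image L).IsContextFree := by
  obtain ⟨g, rfl⟩ := hL
  exact ⟨M.imageGrammar g, language_imageGrammar⟩

end ContextFree

end LetterTransducer

/-! ### Reading three words separated by markers -/

namespace LetterTransducer

open WordHyperbolic

variable {A B Q : Type*}

/-- Steps of the transducer that applies `M` to `u`, `v` and `w` in `u #₁ v #₂ wʳᵉᵛ`, running
backwards on the last word. The second component of a state counts the markers read. -/
inductive TripleStep (M : LetterTransducer A B Q) :
    Q × Fin 3 → A ⊕ Fin 2 → Option (B ⊕ Fin 2) → Q × Fin 3 → Prop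
  | forward {p q : Q} {i : Fin 3} {a : A} {o : Option B} (hi : i ≠ 2) (h : M.step p a o q) :
      TripleStep M (p, i) (.inl a) (o.map .inl) (q, i)
  | marker_one {p q : Q} (hp : p ∈ M.accept) (hq : q ∈ M.start) :
      TripleStep M (p, 0) (.inr 0) (some (.inr 0)) (q, 1)
  | marker_two {p q : Q} (hp : p ∈ M.accept) (hq : q ∈ M.accept) :
      TripleStep M (p, 1) (.inr 1) (some (.inr 1)) (q, 2)
  | backward {p q : Q} {a : A} {o : Option B} (h : M.step q a o p) :
      TripleStep M (p, 2) (.inl a) (o.map .inl) (q, 2)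

/-- The transducer that applies `M` to `u`, `v` and `w` in `u #₁ v #₂ wʳᵉᵛ`. -/
def triple (M : LetterTransducer A B Q) : LetterTransducer (A ⊕ Fin 2) (B ⊕ Fin 2) (Q × Fin 3) where
  step := TripleStep M
  start := {s | s.1 ∈ M.start ∧ s.2 = 0}
  accept := {s | s.1 ∈ M.start ∧ s.2 = 2}

variable {M : LetterTransducer A B Q}

lemma run_triple_forward {p : Q} {i : Fin 3} (hi : i ≠ 2) {w : List A} {x : List (B ⊕ Fin 2)}
    {s : Q × Fin 3} :
    M.triple.Run (p, i) (w.map .inl) x s ↔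
      ∃ q y, M.Run p w y q ∧ x = y.map .inl ∧ s = (q, i) := by
  induction w generalizing p x with
  | nil =>
    simp only [List.map_nil, run_nil_iff]
    constructor
    · rintro ⟨rfl, rfl⟩
      exact ⟨p, [], ⟨rfl, rfl⟩, rfl, rfl⟩
    · rintro ⟨_, _, ⟨rfl, rfl⟩, rfl, rfl⟩
      exact ⟨rfl, rfl⟩
  | cons a w ih =>
    rw [List.map_cons, run_cons_iff]
    constructor
    · rintro ⟨_, _, _, ⟨-, h⟩ | _ | _ | _, hr, rfl⟩
      · obtain ⟨q, y, hy, rfl, rfl⟩ := ih.1 hr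
        refine ⟨q, _, .cons h hy, ?_, rfl⟩
        rw [List.map_append, Option.toList_map]
      · exact absurd rfl hi
    · rintro ⟨q, _, ⟨h⟩, rfl, rfl⟩
      rename_i r o y h hy
      refine ⟨o.map .inl, (r, i), y.map .inl, .forward hi h, ih.2 ⟨q, y, hy, rfl, rfl⟩, ?_⟩
      rw [List.map_append, Option.toList_map]

/-- Undoing the steps of `M` one by one reverses both input and output, which is what the reversed
third word requires. -/
lemma run_triple_backward {p : Q} {w : List A} {x : List (B ⊕ Fin 2)} {s : Q × Fin 3} :
    M.triple.Run (p, 2) (w.reverse.map .inl) x s ↔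
      ∃ q y, M.Run q w y p ∧ x = y.reverse.map .inl ∧ s = (q, 2) := by
  have hrev : ∀ (o : Option B) (y : List B), (o.toList ++ y).reverse.map Sum.inl =
      y.reverse.map Sum.inl ++ (o.map Sum.inl : Option (B ⊕ Fin 2)).toList := by
    rintro (_ | b) y <;> simp
  induction w generalizing x s with
  | nil =>
    simp only [List.reverse_nil, List.map_nil, run_nil_iff]
    constructor
    · rintro ⟨rfl, rfl⟩
      exact ⟨p, [], ⟨rfl, rfl⟩, rfl, rfl⟩
    · rintro ⟨_, _, ⟨rfl, rfl⟩, rfl, rfl⟩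
      exact ⟨rfl, rfl⟩
  | cons a w ih =>
    simp only [List.reverse_cons, List.map_append, List.map_cons, List.map_nil, run_append_iff,
      run_singleton_iff, ih]
    constructor
    · rintro ⟨_, _, _, ⟨q, y, hy, rfl, rfl⟩, ⟨_, h, rfl⟩, rfl⟩
      rcases h with ⟨hi, -⟩ | _ | _ | h
      · exact absurd rfl hi
      · exact ⟨_, _, .cons h hy, (hrev _ _).symm, rfl⟩
    · rintro ⟨q, _, ⟨h⟩, rfl, rfl⟩
      rename_i r o y h hy
      exact ⟨_, _, _, ⟨r, y, hy, rfl, rfl⟩, ⟨_, .backward h, rfl⟩, hrev _ _⟩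

/-- The third run is traversed backwards: it is entered at an accepting state of `M` and left at a
start state. -/
lemma rel_triple_iff {u v w : List A} {x : List (B ⊕ Fin 2)} :
    M.triple.Rel (tripleWord u v w) x ↔
      ∃ u' v' w', M.Rel u u' ∧ M.Rel v v' ∧ M.Rel w w' ∧ x = tripleWord u' v' w' := by
  constructor
  · rintro ⟨⟨p, _⟩, ⟨hp, rfl⟩, ⟨q, _⟩, ⟨hq, rfl⟩, h⟩
    simp only [tripleWord, run_append_iff, run_singleton_iff] at h
    obtain ⟨_, _, _, ⟨_, _, _, ⟨_, _, _, ⟨_, _, _, hu, ⟨_, h₁, rfl⟩, rfl⟩, hv, rfl⟩,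
      ⟨_, h₂, rfl⟩, rfl⟩, hw, rfl⟩ := h
    obtain ⟨q₁, u', hu', rfl, rfl⟩ := (run_triple_forward (by decide)).1 hu
    obtain ⟨⟩ | @⟨_, p₂, hq₁, hp₂⟩ := h₁
    obtain ⟨q₂, v', hv', rfl, rfl⟩ := (run_triple_forward (by decide)).1 hv
    obtain ⟨⟩ | ⟨⟩ | @⟨_, p₃, hq₂, hp₃⟩ := h₂
    obtain ⟨q₃, w', hw', rfl, h⟩ := run_triple_backward.1 hw
    cases h
    exact ⟨u', v', w', ⟨_, hp, _, hq₁, hu'⟩, ⟨_, hp₂, _, hq₂, hv'⟩, ⟨_, hq, _, hp₃, hw'⟩, rfl⟩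
  · rintro ⟨u', v', w', ⟨p₁, hp₁, q₁, hq₁, hu⟩, ⟨p₂, hp₂, q₂, hq₂, hv⟩, ⟨p₃, hp₃, q₃, hq₃, hw⟩, rfl⟩
    refine ⟨(p₁, 0), ⟨hp₁, rfl⟩, (p₃, 2), ⟨hp₃, rfl⟩, ?_⟩
    simp only [tripleWord, run_append_iff, run_singleton_iff]
    exact ⟨(q₃, 2), _, _, ⟨(q₂, 1), _, _, ⟨(p₂, 1), _, _, ⟨(q₁, 0), _, _,
      (run_triple_forward (by decide)).2 ⟨_, _, hu, rfl, rfl⟩, ⟨_, .marker_one hq₁ hp₂, rfl⟩, rfl⟩,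
      (run_triple_forward (by decide)).2 ⟨_, _, hv, rfl, rfl⟩, rfl⟩,
      ⟨_, .marker_two hq₂ hq₃, rfl⟩, rfl⟩, run_triple_backward.2 ⟨_, _, hw, rfl, rfl⟩, rfl⟩

end LetterTransducer

/-! ### Transporting word-hyperbolic structures along transducers -/

namespace WordHyperbolic

variable {A S : Type*} [Semigroup S]

@[simp]
lemma eval_nil (φ : A → S) : eval φ [] = 1 := rfl

@[simp]
lemma eval_cons (φ : A → S) (a : A) (w : List A) : eval φ (a :: w) = φ a * eval φ w := by
  simp [eval]

@[simp]
lemma eval_append (φ : A → S) (u v : List A) : eval φ (u ++ v) = eval φ u * eval φ v := by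
  simp [eval]

lemma eval_eq_one_iff {φ : A → S} {w : List A} : eval φ w = 1 ↔ w = [] := by
  cases w with
  | nil => simp
  | cons a w =>
    rw [eval_cons]
    cases eval φ w using WithOne.recOneCoe with
    | one => simp
    | coe s => simp [← WithOne.coe_mul]

lemma mem_closure_of_eval_eq {φ : A → S} {w : List A} {s : S} (h : eval φ w = s) :
    s ∈ Subsemigroup.closure (Set.range φ) := by
  induction w generalizing s with
  | nil => exact absurd h WithOne.one_ne_coe
  | cons a w ih =>
    have ha : φ a ∈ Subsemigroup.closure (Set.range φ) := Subsemigroup.subset_closure ⟨a, rfl⟩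
    rw [eval_cons] at h
    cases hw : eval φ w using WithOne.recOneCoe with
    | one =>
      rw [hw, mul_one, WithOne.coe_inj] at h
      exact h ▸ ha
    | coe t =>
      rw [hw, ← WithOne.coe_mul, WithOne.coe_inj] at h
      exact h ▸ mul_mem ha (ih hw)

/-- The inclusion of `T` with an identity adjoined in `S` with an identity adjoined. -/
def withOneInclusion (T : Subsemigroup S) : WithOne T →* WithOne S :=
  WithOne.mapMulHom (MulMemClass.subtype T)

@[simp]
lemma withOneInclusion_coe (T : Subsemigroup S) (t : T) : withOneInclusion T t = ((t : S) : WithOne S) := rfl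

lemma withOneInclusion_injective (T : Subsemigroup S) : Function.Injective (withOneInclusion T) :=
  WithOne.mapMulHom_injective Subtype.val_injective

/-- A transducer that rewrites exactly the words representing elements of `T` as words over a
finite alphabet of elements of `T` yields a word-hyperbolic structure for `T`. -/
theorem IsStructure.of_transducer {A B Q : Type} [Finite B] [Finite Q] {φ : A → S} {L : Language A}
    (h : IsStructure φ L) {T : Subsemigroup S} {ψ : B → T} {M : LetterTransducer A B Q}
    (sound : ∀ w x, M.Rel w x → eval φ w = withOneInclusion T (eval ψ x))
    (complete : ∀ w, eval φ w ∈ MonoidHom.mrange (withOneInclusion T) → ∃ x, M.Rel w x) :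
    IsStructure ψ (M.image L) := by
  have hA : Finite A := h.finite_alphabet
  have surj : ∀ t : T, ∃ x ∈ M.image L, eval ψ x = (t : WithOne T) := by
    intro t
    obtain ⟨w, hw, hwt⟩ := h.surjective t
    obtain ⟨x, hx⟩ := complete w ⟨t, hwt.symm⟩
    refine ⟨x, ⟨w, hw, hx⟩, withOneInclusion_injective T ?_⟩
    rw [← sound w x hx, hwt, withOneInclusion_coe]
  refine ⟨inferInstance, ?_, ?_, M.isRegular_image h.regular, surj, ?_⟩
  · refine eq_top_iff.2 fun t _ => ?_
    obtain ⟨x, -, hx⟩ := surj t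
    exact mem_closure_of_eval_eq hx
  · rintro x ⟨w, hw, hx⟩ rfl
    have h₁ := sound w _ hx
    rw [eval_nil, map_one, eval_eq_one_iff] at h₁
    exact h.nonempty_words w hw h₁
  -- Soundness and injectivity of `T¹ → S¹` make `uv = w` equivalent to the same equation between
  -- the rewritten words.
  · convert M.triple.isContextFree_image h.contextFree
    ext x
    constructor
    · rintro ⟨u', ⟨u, hu, hu'⟩, v', ⟨v, hv, hv'⟩, w', ⟨w, hw, hw'⟩, he, rfl⟩
      refine ⟨_, ⟨u, hu, v, hv, w, hw, ?_, rfl⟩,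
        LetterTransducer.rel_triple_iff.2 ⟨u', v', w', hu', hv', hw', rfl⟩⟩
      rw [eval_append, sound _ _ hu', sound _ _ hv', sound _ _ hw', ← map_mul, ← eval_append, he]
    · rintro ⟨_, ⟨u, hu, v, hv, w, hw, he, rfl⟩, hx⟩
      obtain ⟨u', v', w', hu', hv', hw', rfl⟩ := LetterTransducer.rel_triple_iff.1 hx
      refine ⟨u', ⟨u, hu, hu'⟩, v', ⟨v, hv, hv'⟩, w', ⟨w, hw, hw'⟩, withOneInclusion_injective T ?_, rfl⟩
      rw [← sound _ _ hw', ← he, eval_append, eval_append, map_mul, sound _ _ hu', sound _ _ hv']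

end WordHyperbolic

/-! ### Rewriting over a subsemigroup of finite Green index -/

namespace Subsemigroup

open WordHyperbolic

variable {S : Type*} [Semigroup S] {T : Subsemigroup S}

lemma exists_eq_mul_of_relativeR {u v : S} (h : T.relativeR u v) :
    ∃ σ ∈ MonoidHom.mrange (withOneInclusion T), (u : WithOne S) = v * σ := by
  have hu : u ∈ T.rightTranslates v := by
    rw [← show T.rightTranslates u = T.rightTranslates v from h]
    exact .inl rfl
  obtain rfl | ⟨t, ht, rfl⟩ := hu
  · exact ⟨1, one_mem _, (mul_one _).symm⟩
  · exact ⟨t, ⟨(⟨t, ht⟩ : T), rfl⟩, rfl⟩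

lemma exists_eq_mul_of_relativeL {u v : S} (h : T.relativeL u v) :
    ∃ τ ∈ MonoidHom.mrange (withOneInclusion T), (u : WithOne S) = τ * v := by
  have hu : u ∈ T.leftTranslates v := by
    rw [← show T.leftTranslates u = T.leftTranslates v from h]
    exact .inl rfl
  obtain rfl | ⟨t, ht, rfl⟩ := hu
  · exact ⟨1, one_mem _, (one_mul _).symm⟩
  · exact ⟨t, ⟨(⟨t, ht⟩ : T), rfl⟩, rfl⟩

/-- Representatives of the relative `H`-classes in `S \ T`, together with the identity `h none`. -/
lemma exists_representatives (hT : T.greenIndex ≠ ⊤) :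
    ∃ (n : ℕ) (h : Option (Fin n) → WithOne S), h none = 1 ∧
      (∀ k, h k ∈ MonoidHom.mrange (withOneInclusion T) → k = none) ∧
      ∀ x ∉ MonoidHom.mrange (withOneInclusion T), ∃ k,
        (∃ σ ∈ MonoidHom.mrange (withOneInclusion T), x = h k * σ) ∧
        (∃ τ ∈ MonoidHom.mrange (withOneInclusion T), x = τ * h k) ∧
        ∃ τ ∈ MonoidHom.mrange (withOneInclusion T), h k = τ * x := by
  have hfin : {c : Quotient T.relativeH | ∃ s : S, s ∉ T ∧ Quotient.mk T.relativeH s = c}.Finite := by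
    rw [← Set.encard_ne_top_iff]
    rintro h
    exact hT (by rw [greenIndex, h, top_add])
  obtain ⟨n, ⟨e⟩⟩ := (Set.finite_coe_iff.2 hfin).exists_equiv_fin
  choose r hr using fun c : {c : Quotient T.relativeH //
    ∃ s : S, s ∉ T ∧ Quotient.mk T.relativeH s = c} => c.2
  refine ⟨n, fun k => k.elim 1 fun i => (r (e.symm i) : WithOne S), rfl, ?_, ?_⟩
  · rintro (_ | i) ⟨y, hy⟩
    · rfl
    · cases y using WithOne.recOneCoe with
      | one => exact absurd hy WithOne.one_ne_coe
      | coe t => exact absurd (WithOne.coe_inj.1 hy ▸ t.2) (hr (e.symm i)).1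
  · intro x hx
    cases x using WithOne.recOneCoe with
    | one => exact absurd (one_mem _) hx
    | coe s =>
      have hs : s ∉ T := fun hs => hx ⟨(⟨s, hs⟩ : T), rfl⟩
      let c : {c : Quotient T.relativeH // ∃ s : S, s ∉ T ∧ Quotient.mk T.relativeH s = c} :=
        ⟨Quotient.mk _ s, s, hs, rfl⟩
      have hc : T.relativeH (r c) s := Quotient.exact (hr c).2
      refine ⟨some (e c), ?_⟩
      beta_reduce
      rw [show (some (e c)).elim 1 (fun i => (r (e.symm i) : WithOne S)) = r c by
        rw [Option.elim_some, e.symm_apply_apply]]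
      exact ⟨exists_eq_mul_of_relativeR hc.1.symm, exists_eq_mul_of_relativeL hc.2.symm,
        exists_eq_mul_of_relativeL hc.2⟩

end Subsemigroup

namespace WordHyperbolic

variable {A B K S : Type*} [Semigroup S] {T : Subsemigroup S}

/-- The transducer that rewrites words representing elements of `T` as words over elements of `T`:
the first component of a state guesses the representative produced by the remaining input when
pushed to the left, the second one is the representative currently being pushed to the right. -/
def pushTransducer (φ : A → S) (ψ : B → T) (h : K → WithOne S) (k₀ : K) :
    LetterTransducer A B (K × K) where
  step p a o q := ∃ σ, φ a * h q.1 = h p.1 * σ ∧ h p.2 * σ = withOneInclusion T (eval ψ o.toList) * h q.2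
  start := {p | p.1 = p.2}
  accept := {(k₀, k₀)}

variable {φ : A → S} {ψ : B → T} {h : K → WithOne S} {k₀ : K}

/-- The factors `σ` of the single steps multiply up. At a start state `p.1 = p.2`, so both
expressions agree and the output represents the input. -/
lemma exists_of_run_pushTransducer (hk₀ : h k₀ = 1) {p q : K × K} {w : List A} {x : List B}
    (hw : (pushTransducer φ ψ h k₀).Run p w x q) (hq : q = (k₀, k₀)) :
    ∃ σ, eval φ w = h p.1 * σ ∧ h p.2 * σ = withOneInclusion T (eval ψ x) := by
  induction hw with
  | nil => exact ⟨1, by simp [hq, hk₀], by simp [hq, hk₀]⟩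
  | cons hstep _ ih =>
    obtain ⟨σ, h₁, h₂⟩ := hstep
    obtain ⟨σ', h₃, h₄⟩ := ih hq
    refine ⟨σ * σ', ?_, ?_⟩
    · rw [eval_cons, h₃, ← mul_assoc, h₁, mul_assoc]
    · rw [eval_append, map_mul, ← h₄, ← mul_assoc, h₂, mul_assoc]

/-- The class `k` and the factor `σ` are fixed by the word from right to left, while `m` stays
arbitrary so that the induction can change it at each letter. -/
lemma exists_run_pushTransducer {right left : WithOne S → WithOne S} {cls : WithOne S → K}
    {cls' : WithOne S → K} (hk₀ : h k₀ = 1)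
    (hT : ∀ k, h k ∈ MonoidHom.mrange (withOneInclusion T) → k = k₀)
    (hright : ∀ x, right x ∈ MonoidHom.mrange (withOneInclusion T) ∧ x = h (cls x) * right x)
    (hleft : ∀ x, x = left x * h (cls' x) ∧
      (cls' x = k₀ ∨ ∃ τ ∈ MonoidHom.mrange (withOneInclusion T), h (cls' x) = τ * x))
    (hψ : ∀ m a k, ∃ o : Option B,
      left (h m * right (φ a * h k)) = withOneInclusion T (eval ψ o.toList)) (w : List A) :
    ∃ k, ∃ σ ∈ MonoidHom.mrange (withOneInclusion T), eval φ w = h k * σ ∧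
      ∀ m, h m * σ ∈ MonoidHom.mrange (withOneInclusion T) →
        ∃ x, (pushTransducer φ ψ h k₀).Run (k, m) w x (k₀, k₀) := by
  induction w with
  | nil =>
    refine ⟨k₀, 1, one_mem _, by simp [hk₀], fun m hm => ⟨[], ?_⟩⟩
    rw [mul_one] at hm
    rw [hT m hm]
    exact .nil _
  | cons a w ih =>
    obtain ⟨k, σ, hσ, hw, ih⟩ := ih
    obtain ⟨hr, hr'⟩ := hright (φ a * h k)
    refine ⟨cls (φ a * h k), right (φ a * h k) * σ, mul_mem hr hσ, ?_, fun m hm => ?_⟩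
    · rw [eval_cons, hw, ← mul_assoc, ← mul_assoc, ← hr']
    · obtain ⟨hl, hl'⟩ := hleft (h m * right (φ a * h k))
      obtain ⟨o, ho⟩ := hψ m a k
      -- Membership in `T¹` passes to the remaining product: either the new representative is `1`,
      -- or it is a left `T¹`-multiple of the old `h m * right _`.
      obtain ⟨x, hx⟩ := ih (cls' (h m * right (φ a * h k))) (by
        obtain hl' | ⟨τ, hτ, hl'⟩ := hl'
        · rwa [hl', hk₀, one_mul]
        · rw [hl', mul_assoc, mul_assoc]
          exact mul_mem hτ hm)
      exact ⟨_, .cons ⟨right (φ a * h k), hr', by rw [← ho]; exact hl⟩ hx⟩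

end WordHyperbolic

open WordHyperbolic in
/-- Word-hyperbolicity is inherited by subsemigroups of finite Green index. -/
theorem mainTheorem2 {S : Type*} [Semigroup S] (T : Subsemigroup S)
    (hT : T.greenIndex ≠ ⊤) (hS : IsWordHyperbolic S) : IsWordHyperbolic T := by
  obtain ⟨A, φ, L, hL⟩ := hS
  have hA : Finite A := hL.finite_alphabet
  obtain ⟨n, h, h₀, hne, hrep⟩ := T.exists_representatives hT
  have hR : ∀ x, ∃ k, ∃ σ ∈ MonoidHom.mrange (withOneInclusion T), x = h k * σ := fun x => by
    by_cases hx : x ∈ MonoidHom.mrange (withOneInclusion T)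
    · exact ⟨none, x, hx, by rw [h₀, one_mul]⟩
    · obtain ⟨k, hk, -⟩ := hrep x hx
      exact ⟨k, hk⟩
  have hL' : ∀ x, ∃ k, ∃ τ ∈ MonoidHom.mrange (withOneInclusion T), x = τ * h k ∧
      (k = none ∨ ∃ τ ∈ MonoidHom.mrange (withOneInclusion T), h k = τ * x) := fun x => by
    by_cases hx : x ∈ MonoidHom.mrange (withOneInclusion T)
    · exact ⟨none, x, hx, by rw [h₀, mul_one], .inl rfl⟩
    · obtain ⟨k, -, ⟨τ, hτ, hk⟩, hk'⟩ := hrep x hx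
      exact ⟨k, τ, hτ, hk, .inr hk'⟩
  choose cls right hright using hR
  choose cls' left hleft hleft' using hL'
  let letter (d : Option (Fin n) × A × Option (Fin n)) : WithOne S :=
    left (h d.1 * right (φ d.2.1 * h d.2.2))
  have hfin : {t : T | withOneInclusion T t ∈ Set.range letter}.Finite :=
    (Set.finite_range letter).preimage
      ((withOneInclusion_injective T).comp WithOne.coe_injective).injOn
  obtain ⟨N, ⟨e⟩⟩ := (Set.finite_coe_iff.2 hfin).exists_equiv_fin
  let ψ (i : Fin N) : T := e.symm i
  have hψ : ∀ m a k, ∃ o : Option (Fin N),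
      left (h m * right (φ a * h k)) = withOneInclusion T (eval ψ o.toList) := by
    intro m a k
    obtain ⟨y, hy⟩ := hleft (h m * right (φ a * h k))
    cases y using WithOne.recOneCoe with
    -- A left factor equal to the adjoined identity is written as no letter at all.
    | one => exact ⟨none, by rw [← hy]; rfl⟩
    | coe t =>
      refine ⟨some (e ⟨t, (m, a, k), hy.symm⟩), ?_⟩
      simp only [Option.toList_some, eval_cons, eval_nil, mul_one, ψ, Equiv.symm_apply_apply, hy]
  refine ⟨Fin N, ψ, _, hL.of_transducer (M := pushTransducer φ ψ h none) ?_ ?_⟩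
  · rintro w x ⟨⟨k, m⟩, rfl : k = m, q, hq, hrun⟩
    obtain ⟨σ, h₁, h₂⟩ := exists_of_run_pushTransducer h₀ hrun hq
    exact h₁.trans h₂
  · intro w hw
    obtain ⟨k, σ, -, hk, hrun⟩ :=
      exists_run_pushTransducer h₀ hne hright hleft' hψ w
    -- Taking `m = k` starts the run on the diagonal; there `h m * σ` is the value of `w`.
    obtain ⟨x, hx⟩ := hrun k (hk ▸ hw)
    exact ⟨x, (k, k), rfl, (none, none), rfl, hx⟩
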